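/- Let $k$ be a field of characteristic zero and let $L$ be a Lie algebra over $k$ (of any dimension) with a filtration by subspaces $L = L^1 \supseteq L^2 \supseteq L^3 \supseteq \cdots$ such that $[L^i, L^j] \subseteq L^{i+j}$ for all $i,j$. Let $\mathrm{gr}\, L = \bigoplus_{i\ge 1} L^i/L^{i+1}$ be the associated graded Lie algebra. Filter the enveloping algebra $U(L)$ by $$F^p = \sum_{n \ge 0,\; i_1+\cdots+i_n \ge p} L^{i_1} L^{i_2}\cdots L^{i_n} \qquad (p \ge 0),$$ the span of all products $x_1\cdots x_n$ with $x_j\in L^{i_j}$ and $i_1+\cdots+i_n\ge p$. This is a decreasing filtration with $F^pF^q\subseteq F^{p+q}$; let $\mathrm{gr}\, U(L) = \bigoplus_{p\ge 0} F^p/F^{p+1}$ be the associated graded algebra. Grade $U(\mathrm{gr}\, L)$ by letting $U(\mathrm{gr}\, L)_d$ be the span of all products of homogeneous elements of $\mathrm{gr}\, L$ of total degree $d$. (1) The natural algebra map $U(\mathrm{gr}\, L) \to \mathrm{gr}\, U(L)$, which sends the class in $L^i/L^{i+1}$ of $x\in L^i$ to the class of $x$ in $F^i/F^{i+1}$, is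 an isomorphism of graded algebras: it is bijective and maps $U(\mathrm{gr}\, L)_d$ onto $F^d/F^{d+1}$ for every $d \geq 0$. (2) Let $U(L)_+$ be the augmentation ideal and let $R^0 = U(L)$, $R^1 = U(L)_+$ and $R^{p+1} = R^p\cdot U(L)_+ + (L^{p+1})$ for $p\ge 1$, where $(L^{p+1})$ is the two-sided ideal generated by $L^{p+1}$. Then $R^p\subseteq F^p$ for all $p$; and if $R^pR^q\subseteq R^{p+q}$ for all $p,q$ (which is what is needed for $\bigoplus_p R^p/R^{p+1}$ to be a graded algebra with product $[a][b]=[ab]$), then $R^p=F^p$ for all $p$. -/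

import Mathlib

open scoped DirectSum

noncomputable section

section AssociatedGraded

variable {k V W X : Type*} [Field k] [AddCommGroup V] [Module k V] [AddCommGroup W] [Module k W]
  [AddCommGroup X] [Module k X]

/-- The `i`-th piece `Fⁱ / Fⁱ⁺¹` of the associated graded space of a decreasing filtration. -/
abbrev GrPiece (F : ℕ → Submodule k V) (i : ℕ) : Type _ :=
  F i ⧸ (F (i + 1)).comap (F i).subtype

/-- The associated graded space `⨁ i, Fⁱ / Fⁱ⁺¹`. -/
def GrSpace (F : ℕ → Submodule k V) : Type _ := ⨁ i, GrPiece F i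

instance (F : ℕ → Submodule k V) : AddCommGroup (GrSpace F) :=
  inferInstanceAs (AddCommGroup (⨁ i, GrPiece F i))

instance (F : ℕ → Submodule k V) : Module k (GrSpace F) :=
  inferInstanceAs (Module k (⨁ i, GrPiece F i))

/-- The inclusion of `Fⁱ / Fⁱ⁺¹` in the associated graded space. -/
def grOf (F : ℕ → Submodule k V) (i : ℕ) : GrPiece F i →ₗ[k] GrSpace F :=
  DirectSum.lof k ℕ (GrPiece F) i

/-- The linear map on the associated graded space with prescribed restrictions to the pieces. -/
def grLift (F : ℕ → Submodule k V) (f : ∀ i, GrPiece F i →ₗ[k] X) : GrSpace F →ₗ[k] X :=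
  DirectSum.toModule k ℕ X f

theorem grLift_grOf (F : ℕ → Submodule k V) (f : ∀ i, GrPiece F i →ₗ[k] X) (i : ℕ)
    (x : GrPiece F i) : grLift F f (grOf F i x) = f i x :=
  DirectSum.toModule_lof k i x

/-- The class in `Fⁱ / Fⁱ⁺¹`, viewed in the associated graded space, of `x ∈ Fⁱ`. -/
def grClass (F : ℕ → Submodule k V) (i : ℕ) : F i →ₗ[k] GrSpace F :=
  grOf F i ∘ₗ Submodule.mkQ _

/-- The linear maps on graded pieces induced by a filtered linear map `f`. -/
def grMapPiece (F : ℕ → Submodule k V) (G : ℕ → Submodule k W) (f : V →ₗ[k] W)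
    (hf : ∀ i, ∀ x ∈ F i, f x ∈ G i) (i : ℕ) : GrPiece F i →ₗ[k] GrPiece G i :=
  Submodule.mapQ _ _ (f.restrict (hf i))
    (fun x hx => Submodule.mem_comap.2 (hf (i + 1) x (Submodule.mem_comap.1 hx)))

/-- The linear map on associated graded spaces induced by a filtered linear map `f`. -/
def grMap (F : ℕ → Submodule k V) (G : ℕ → Submodule k W) (f : V →ₗ[k] W)
    (hf : ∀ i, ∀ x ∈ F i, f x ∈ G i) : GrSpace F →ₗ[k] GrSpace G :=
  grLift F fun i => grOf G i ∘ₗ grMapPiece F G f hf i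

theorem grMap_grClass (F : ℕ → Submodule k V) (G : ℕ → Submodule k W) (f : V →ₗ[k] W)
    (hf : ∀ i, ∀ x ∈ F i, f x ∈ G i) (i : ℕ) (x : F i) :
    grMap F G f hf (grClass F i x) = grClass G i ⟨f x, hf i x x.2⟩ := by
  simp only [grMap, grClass, LinearMap.comp_apply, grLift_grOf]
  rfl

/-- The pairing `Fⁱ / Fⁱ⁺¹ × Fʲ / Fʲ⁺¹ → Fⁱ⁺ʲ / Fⁱ⁺ʲ⁺¹`, `([x], [y]) ↦ [b x y]`, induced by a
bilinear map `b` with `b (Fⁱ, Fʲ) ⊆ Fⁱ⁺ʲ`. -/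
def grBilinPiece (F : ℕ → Submodule k V) (b : V →ₗ[k] V →ₗ[k] V)
    (hb : ∀ i j, ∀ x ∈ F i, ∀ y ∈ F j, b x y ∈ F (i + j)) (i j : ℕ) :
    GrPiece F i →ₗ[k] GrPiece F j →ₗ[k] GrPiece F (i + j) :=
  Submodule.liftQ _
    (LinearMap.mk₂ k
      (fun (x : F i) (y : GrPiece F j) =>
        Submodule.mapQ _ ((F (i + j + 1)).comap (F (i + j)).subtype)
          ((b x).restrict (hb i j x x.2))
          (fun y hy => Submodule.mem_comap.2 (hb i (j + 1) x x.2 y (Submodule.mem_comap.1 hy))) y)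
      (fun x₁ x₂ y => by
        obtain ⟨y, rfl⟩ := Submodule.Quotient.mk_surjective _ y
        simp only [Submodule.mapQ_apply, ← Submodule.Quotient.mk_add]
        congr 1
        ext
        simp)
      (fun c x y => by
        obtain ⟨y, rfl⟩ := Submodule.Quotient.mk_surjective _ y
        simp only [Submodule.mapQ_apply, ← Submodule.Quotient.mk_smul]
        congr 1
        ext
        simp)
      (fun x y₁ y₂ => map_add _ _ _)
      (fun c x y => map_smul _ _ _))
    (fun x hx => by
      rw [LinearMap.mem_ker]
      ext y
      simp only [LinearMap.comp_apply, LinearMap.mk₂_apply, Submodule.mkQ_apply,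
        Submodule.mapQ_apply, LinearMap.zero_apply]
      rw [Submodule.Quotient.mk_eq_zero]
      have h := hb (i + 1) j x (Submodule.mem_comap.1 hx) y y.2
      rw [Nat.add_right_comm] at h
      exact Submodule.mem_comap.2 h)

/-- The bilinear operation on the associated graded space induced by a filtered bilinear
operation `b`. -/
def grBilin (F : ℕ → Submodule k V) (b : V →ₗ[k] V →ₗ[k] V)
    (hb : ∀ i j, ∀ x ∈ F i, ∀ y ∈ F j, b x y ∈ F (i + j)) :
    GrSpace F →ₗ[k] GrSpace F →ₗ[k] GrSpace F :=
  grLift F fun i => LinearMap.flip <| grLift F fun j =>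
    ((grBilinPiece F b hb i j).compr₂ (grOf F (i + j))).flip

theorem grBilin_grClass (F : ℕ → Submodule k V) (b : V →ₗ[k] V →ₗ[k] V)
    (hb : ∀ i j, ∀ x ∈ F i, ∀ y ∈ F j, b x y ∈ F (i + j)) (i j : ℕ) (x : F i) (y : F j) :
    grBilin F b hb (grClass F i x) (grClass F j y)
      = grClass F (i + j) ⟨b x y, hb i j x x.2 y y.2⟩ := by
  simp only [grBilin, grClass, LinearMap.comp_apply, grLift_grOf, LinearMap.flip_apply]
  rfl

theorem grClass_congr (F : ℕ → Submodule k V) {i j : ℕ} (h : i = j) (x : F i) (y : F j)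
    (hxy : (x : V) = y) : grClass F i x = grClass F j y := by
  subst h
  congr 1
  exact Subtype.ext hxy

theorem gr_induction (F : ℕ → Submodule k V) {p : GrSpace F → Prop} (x : GrSpace F)
    (h0 : p 0) (hadd : ∀ x y, p x → p y → p (x + y)) (hc : ∀ i (x : F i), p (grClass F i x)) :
    p x := by
  induction x using DirectSum.induction_on with
  | zero => exact h0
  | of i x =>
    obtain ⟨x, rfl⟩ := Submodule.Quotient.mk_surjective _ x
    exact hc i x
  | add x y hx hy => exact hadd x y hx hy

end AssociatedGraded

section FilteredLie

variable {k L : Type*} [Field k] [LieRing L] [LieAlgebra k L]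

variable (k L) in
/-- A filtration `L = L¹ ⊇ L² ⊇ L³ ⊇ ⋯` of a Lie algebra by subspaces with
`[Lⁱ, Lʲ] ⊆ Lⁱ⁺ʲ`. By antitonicity the extra term `L⁰` is `L` as well, so that the piece of
degree `0` of the associated graded Lie algebra is zero. -/
structure LieFiltration where
  /-- the subspace `Lⁱ` -/
  toFun : ℕ → Submodule k L
  antitone : Antitone toFun
  one_eq_top : toFun 1 = ⊤
  lie_mem : ∀ i j, ∀ x ∈ toFun i, ∀ y ∈ toFun j, ⁅x, y⁆ ∈ toFun (i + j)

namespace LieFiltration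

variable (F : LieFiltration k L)

/-- The associated graded Lie algebra `gr L = ⨁ i, Lⁱ / Lⁱ⁺¹`. -/
def Gr : Type _ := GrSpace F.toFun

instance : AddCommGroup F.Gr := inferInstanceAs (AddCommGroup (GrSpace F.toFun))

instance : Module k F.Gr := inferInstanceAs (Module k (GrSpace F.toFun))

/-- The class in `Lⁱ / Lⁱ⁺¹ ⊆ gr L` of `x ∈ Lⁱ`. -/
def cls (i : ℕ) : F.toFun i →ₗ[k] F.Gr := grClass F.toFun i

/-- The bracket of `gr L`, given by `[[x], [y]] = [[x, y]]` on classes. -/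
def bracketGr : F.Gr →ₗ[k] F.Gr →ₗ[k] F.Gr :=
  grBilin F.toFun
    (LinearMap.mk₂ k (fun x y : L => ⁅x, y⁆) add_lie smul_lie lie_add (fun c x y => lie_smul c x y))
    F.lie_mem

theorem bracketGr_cls (i j : ℕ) (x : F.toFun i) (y : F.toFun j) :
    F.bracketGr (F.cls i x) (F.cls j y)
      = F.cls (i + j) ⟨⁅(x : L), (y : L)⁆, F.lie_mem i j x x.2 y y.2⟩ :=
  grBilin_grClass _ _ _ _ _ _ _

theorem cls_congr {i j : ℕ} (h : i = j) (x : F.toFun i) (y : F.toFun j)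
    (hxy : (x : L) = y) : F.cls i x = F.cls j y :=
  grClass_congr _ h x y hxy

theorem gr_ind {p : F.Gr → Prop} (x : F.Gr)
    (h0 : p 0) (hadd : ∀ x y, p x → p y → p (x + y)) (hc : ∀ i x, p (F.cls i x)) : p x :=
  gr_induction F.toFun x h0 hadd hc

theorem bracketGr_skew (x y : F.Gr) : F.bracketGr x y = - F.bracketGr y x := by
  induction x using F.gr_ind with
  | h0 => simp
  | hadd x₁ x₂ h₁ h₂ => simp [h₁, h₂, add_comm]
  | hc i x =>
    induction y using F.gr_ind with
    | h0 => simp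
    | hadd y₁ y₂ h₁ h₂ => simp [h₁, h₂, add_comm]
    | hc j y =>
      rw [bracketGr_cls, bracketGr_cls, ← map_neg]
      exact F.cls_congr (add_comm i j) _ _ (by simp)

theorem bracketGr_self (x : F.Gr) : F.bracketGr x x = 0 := by
  induction x using F.gr_ind with
  | h0 => simp
  | hadd x₁ x₂ h₁ h₂ =>
    rw [map_add, map_add, LinearMap.add_apply, LinearMap.add_apply, h₁, h₂,
      F.bracketGr_skew x₁ x₂]
    simp
  | hc i x =>
    rw [bracketGr_cls, ← map_zero (F.cls (i + i))]
    exact F.cls_congr rfl _ _ (by simp)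

theorem bracketGr_leibniz (x y z : F.Gr) :
    F.bracketGr x (F.bracketGr y z)
      = F.bracketGr (F.bracketGr x y) z + F.bracketGr y (F.bracketGr x z) := by
  induction x using F.gr_ind with
  | h0 => simp
  | hadd x₁ x₂ h₁ h₂ => simp only [map_add, LinearMap.add_apply, h₁, h₂]; abel
  | hc i x =>
    induction y using F.gr_ind with
    | h0 => simp
    | hadd x₁ x₂ h₁ h₂ => simp only [map_add, LinearMap.add_apply, h₁, h₂]; abel
    | hc j y =>
      induction z using F.gr_ind with
      | h0 => simp
      | hadd x₁ x₂ h₁ h₂ => simp only [map_add, h₁, h₂]; abel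
      | hc l z =>
        simp only [bracketGr_cls]
        rw [F.cls_congr (show j + (i + l) = i + j + l by omega)
            ⟨⁅(y : L), ⁅(x : L), (z : L)⁆⁆,
              F.lie_mem _ _ _ y.2 _ (F.lie_mem _ _ _ x.2 _ z.2)⟩
            ⟨⁅(y : L), ⁅(x : L), (z : L)⁆⁆, by
              have h := F.lie_mem _ _ _ y.2 _ (F.lie_mem _ _ _ x.2 _ z.2)
              rwa [show j + (i + l) = i + j + l by omega] at h⟩ rfl,
          ← map_add]
        exact F.cls_congr (by omega) _ _ (leibniz_lie (x : L) (y : L) (z : L))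

instance : LieRing F.Gr where
  bracket x y := F.bracketGr x y
  add_lie x y z := by simp
  lie_add x y z := by simp
  lie_self x := F.bracketGr_self x
  leibniz_lie x y z := F.bracketGr_leibniz x y z

instance : LieAlgebra k F.Gr where
  lie_smul c x y := map_smul (F.bracketGr x) c y

theorem lie_cls (i j : ℕ) (x : F.toFun i) (y : F.toFun j) :
    ⁅F.cls i x, F.cls j y⁆
      = F.cls (i + j) ⟨⁅(x : L), (y : L)⁆, F.lie_mem i j x x.2 y y.2⟩ :=
  F.bracketGr_cls i j x y

end LieFiltration

end FilteredLie

section FilteredAlgebra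

variable {k A : Type*} [Field k] [Ring A] [Algebra k A]

variable (k A) in
/-- A multiplicative filtration `A⁰ ⊇ A¹ ⊇ A² ⊇ ⋯` of an algebra, with `1 ∈ A⁰`. -/
structure AlgFiltration where
  /-- the subspace `Aⁱ` -/
  toFun : ℕ → Submodule k A
  antitone : Antitone toFun
  one_mem : (1 : A) ∈ toFun 0
  mul_mem : ∀ i j, ∀ x ∈ toFun i, ∀ y ∈ toFun j, x * y ∈ toFun (i + j)

namespace AlgFiltration

variable (F : AlgFiltration k A)

/-- The associated graded algebra `gr A = ⨁ i, Aⁱ / Aⁱ⁺¹`. -/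
def Gr : Type _ := GrSpace F.toFun

instance : AddCommGroup F.Gr := inferInstanceAs (AddCommGroup (GrSpace F.toFun))

instance : Module k F.Gr := inferInstanceAs (Module k (GrSpace F.toFun))

/-- The class in `Aⁱ / Aⁱ⁺¹ ⊆ gr A` of `x ∈ Aⁱ`. -/
def cls (i : ℕ) : F.toFun i →ₗ[k] F.Gr := grClass F.toFun i

/-- The component `Aⁱ / Aⁱ⁺¹` of degree `i` of `gr A`. -/
def degree (i : ℕ) : Submodule k F.Gr := LinearMap.range (F.cls i)

/-- The multiplication of `gr A`, given by `[x] * [y] = [x * y]` on classes. -/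
def mulGr : F.Gr →ₗ[k] F.Gr →ₗ[k] F.Gr := grBilin F.toFun (LinearMap.mul k A) F.mul_mem

theorem mulGr_cls (i j : ℕ) (x : F.toFun i) (y : F.toFun j) :
    F.mulGr (F.cls i x) (F.cls j y)
      = F.cls (i + j) ⟨(x : A) * (y : A), F.mul_mem i j x x.2 y y.2⟩ :=
  grBilin_grClass _ _ _ _ _ _ _

theorem cls_congr {i j : ℕ} (h : i = j) (x : F.toFun i) (y : F.toFun j)
    (hxy : (x : A) = y) : F.cls i x = F.cls j y :=
  grClass_congr _ h x y hxy

theorem gr_ind {p : F.Gr → Prop} (x : F.Gr)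
    (h0 : p 0) (hadd : ∀ x y, p x → p y → p (x + y)) (hc : ∀ i x, p (F.cls i x)) : p x :=
  gr_induction F.toFun x h0 hadd hc

instance : Mul F.Gr := ⟨fun x y => F.mulGr x y⟩

instance : One F.Gr := ⟨F.cls 0 ⟨1, F.one_mem⟩⟩

theorem mul_def (x y : F.Gr) : x * y = F.mulGr x y := rfl

theorem one_def : (1 : F.Gr) = F.cls 0 ⟨1, F.one_mem⟩ := rfl

theorem mulGr_one (x : F.Gr) : F.mulGr x (F.cls 0 ⟨1, F.one_mem⟩) = x := by
  induction x using F.gr_ind with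
  | h0 => simp
  | hadd x₁ x₂ h₁ h₂ => simp [h₁, h₂]
  | hc i x =>
    rw [mulGr_cls]
    exact F.cls_congr (by omega) _ _ (by simp)

theorem one_mulGr (x : F.Gr) : F.mulGr (F.cls 0 ⟨1, F.one_mem⟩) x = x := by
  induction x using F.gr_ind with
  | h0 => simp
  | hadd x₁ x₂ h₁ h₂ => simp [h₁, h₂]
  | hc i x =>
    rw [mulGr_cls]
    exact F.cls_congr (by omega) _ _ (by simp)

theorem mulGr_assoc (x y z : F.Gr) :
    F.mulGr (F.mulGr x y) z = F.mulGr x (F.mulGr y z) := by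
  induction x using F.gr_ind with
  | h0 => simp
  | hadd x₁ x₂ h₁ h₂ => simp [h₁, h₂]
  | hc i x =>
    induction y using F.gr_ind with
    | h0 => simp
    | hadd x₁ x₂ h₁ h₂ => simp [h₁, h₂]
    | hc j y =>
      induction z using F.gr_ind with
      | h0 => simp
      | hadd x₁ x₂ h₁ h₂ => simp [h₁, h₂]
      | hc l z =>
        simp only [mulGr_cls]
        exact F.cls_congr (by omega) _ _ (mul_assoc _ _ _)

instance : Ring F.Gr where
  left_distrib x y z := map_add (F.mulGr x) y z
  right_distrib x y z := by simp [mul_def]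
  zero_mul x := by simp [mul_def]
  mul_zero x := map_zero (F.mulGr x)
  mul_assoc := F.mulGr_assoc
  one_mul := F.one_mulGr
  mul_one := F.mulGr_one
  neg_add_cancel := neg_add_cancel
  zsmul := fun n x => n • x
  zsmul_zero' := SubNegMonoid.zsmul_zero'
  zsmul_succ' := SubNegMonoid.zsmul_succ'
  zsmul_neg' := SubNegMonoid.zsmul_neg'
  sub_eq_add_neg := sub_eq_add_neg

instance : Algebra k F.Gr :=
  Algebra.ofModule (fun c x y => by simp [mul_def]) (fun c x y => by simp [mul_def])

theorem cls_mul_cls (i j : ℕ) (x : F.toFun i) (y : F.toFun j) :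
    F.cls i x * F.cls j y
      = F.cls (i + j) ⟨(x : A) * (y : A), F.mul_mem i j x x.2 y y.2⟩ :=
  F.mulGr_cls i j x y

end AlgFiltration

end FilteredAlgebra

section Enveloping

attribute [local instance 100] LieRing.ofAssociativeRing

variable {k L : Type*} [Field k] [LieRing L] [LieAlgebra k L]

namespace LieFiltration

variable (F : LieFiltration k L)

/-- The subspace `Fᵖ = ∑ Lⁱ¹ ⋯ Lⁱⁿ` (the sum over all `n ≥ 0` and `i₁ + ⋯ + iₙ ≥ p`) of the
enveloping algebra. -/
def envSubspace (p : ℕ) : Submodule k (UniversalEnvelopingAlgebra k L) :=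
  Submodule.span k
    {u | ∃ l : List (ℕ × L), (∀ a ∈ l, a.2 ∈ F.toFun a.1) ∧ p ≤ (l.map Prod.fst).sum ∧
      u = (l.map fun a => UniversalEnvelopingAlgebra.ι k a.2).prod}

/-- The filtration of the enveloping algebra induced by the filtration of `L`. -/
def env : AlgFiltration k (UniversalEnvelopingAlgebra k L) where
  toFun := F.envSubspace
  antitone p q hpq := Submodule.span_mono fun _ ⟨l, h₁, h₂, h₃⟩ => ⟨l, h₁, hpq.trans h₂, h₃⟩
  one_mem := Submodule.subset_span ⟨[], by simp⟩
  mul_mem p q x hx y hy := by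
    have h : F.envSubspace p * F.envSubspace q ≤ F.envSubspace (p + q) := by
      unfold envSubspace
      rw [Submodule.span_mul_span]
      refine Submodule.span_mono ?_
      rintro _ ⟨_, ⟨l, h₁, h₂, rfl⟩, _, ⟨m, g₁, g₂, rfl⟩, rfl⟩
      refine ⟨l ++ m, ?_, ?_, by simp⟩
      · intro a ha
        rcases List.mem_append.1 ha with ha | ha
        · exact h₁ a ha
        · exact g₁ a ha
      · simpa using add_le_add h₂ g₂
    exact h (Submodule.mul_mem_mul hx hy)

theorem ι_mem_env (i : ℕ) (x : L) (hx : x ∈ F.toFun i) :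
    (UniversalEnvelopingAlgebra.ι k : L →ₗ⁅k⁆ UniversalEnvelopingAlgebra k L).toLinearMap x
      ∈ F.env.toFun i :=
  Submodule.subset_span ⟨[(i, x)], by simpa using hx, by simp, by simp⟩

/-- The linear map underlying `grToGrEnv`. -/
def grToGrEnvLin : F.Gr →ₗ[k] F.env.Gr :=
  grMap F.toFun F.env.toFun (UniversalEnvelopingAlgebra.ι k).toLinearMap F.ι_mem_env

theorem grToGrEnvLin_cls (i : ℕ) (x : F.toFun i) :
    F.grToGrEnvLin (F.cls i x)
      = F.env.cls i ⟨UniversalEnvelopingAlgebra.ι k (x : L), F.ι_mem_env i x x.2⟩ :=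
  grMap_grClass _ _ _ _ _ _

theorem grToGrEnvLin_lie (x y : F.Gr) :
    F.grToGrEnvLin ⁅x, y⁆
      = F.grToGrEnvLin x * F.grToGrEnvLin y - F.grToGrEnvLin y * F.grToGrEnvLin x := by
  induction x using F.gr_ind with
  | h0 => simp
  | hadd x₁ x₂ h₁ h₂ => simp only [add_lie, map_add, h₁, h₂, add_mul, mul_add]; abel
  | hc i x =>
    induction y using F.gr_ind with
    | h0 => simp
    | hadd y₁ y₂ h₁ h₂ => simp only [lie_add, map_add, h₁, h₂, add_mul, mul_add]; abel
    | hc j y =>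
      rw [lie_cls, grToGrEnvLin_cls, grToGrEnvLin_cls, grToGrEnvLin_cls, F.env.cls_mul_cls,
        F.env.cls_mul_cls, F.env.cls_congr (add_comm j i)
          ⟨UniversalEnvelopingAlgebra.ι k (y : L) * UniversalEnvelopingAlgebra.ι k (x : L),
            F.env.mul_mem _ _ _ (F.ι_mem_env j y y.2) _ (F.ι_mem_env i x x.2)⟩
          ⟨UniversalEnvelopingAlgebra.ι k (y : L) * UniversalEnvelopingAlgebra.ι k (x : L), by
            have h := F.env.mul_mem _ _ _ (F.ι_mem_env j y y.2) _ (F.ι_mem_env i x x.2)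
            rwa [add_comm j i] at h⟩ rfl, ← map_sub]
      refine F.env.cls_congr rfl _ _ ?_
      exact (LieHom.map_lie _ _ _).trans (LieRing.of_associative_ring_bracket _ _)

/-- The morphism of Lie algebras `gr L → gr U(L)` sending the class in `Lⁱ / Lⁱ⁺¹` of `x ∈ Lⁱ` to
the class in `Fⁱ / Fⁱ⁺¹` of `x`. -/
def grToGrEnv : F.Gr →ₗ⁅k⁆ F.env.Gr where
  toFun := F.grToGrEnvLin
  map_add' := map_add F.grToGrEnvLin
  map_smul' := map_smul F.grToGrEnvLin
  map_lie' {x y} :=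
    (F.grToGrEnvLin_lie x y).trans (LieRing.of_associative_ring_bracket _ _).symm

/-- The natural map `U(gr L) → gr U(L)`. -/
def naturalMap : UniversalEnvelopingAlgebra k F.Gr →ₐ[k] F.env.Gr :=
  UniversalEnvelopingAlgebra.lift k F.grToGrEnv

theorem naturalMap_ι_cls (i : ℕ) (x : F.toFun i) :
    F.naturalMap (UniversalEnvelopingAlgebra.ι k (F.cls i x))
      = F.env.cls i ⟨UniversalEnvelopingAlgebra.ι k (x : L), F.ι_mem_env i x x.2⟩ := by
  rw [naturalMap, UniversalEnvelopingAlgebra.lift_ι_apply]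
  exact F.grToGrEnvLin_cls i x

/-- The component `U(gr L)_d` of degree `d` of the enveloping algebra of the graded Lie algebra
`gr L`: the span of the products of homogeneous elements of `gr L` of total degree `d`. -/
def envGrDegree (d : ℕ) : Submodule k (UniversalEnvelopingAlgebra k F.Gr) :=
  Submodule.span k
    {u | ∃ l : List (Σ i, F.toFun i), (l.map Sigma.fst).sum = d ∧
      u = (l.map fun a => UniversalEnvelopingAlgebra.ι k (F.cls a.1 a.2)).prod}

variable (k L) in
/-- The augmentation ideal `U(L)₊`, the kernel of the counit `U(L) → k`. -/
def augmentation : Submodule k (UniversalEnvelopingAlgebra k L) :=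
  LinearMap.ker (UniversalEnvelopingAlgebra.lift k (0 : L →ₗ⁅k⁆ k)).toLinearMap

/-- The subspaces `R⁰ = U(L)`, `R¹ = U(L)₊` and `Rᵖ⁺¹ = Rᵖ · U(L)₊ + (Lᵖ⁺¹)` for `p ≥ 1`, where
`(Lᵖ⁺¹)` is the two-sided ideal generated by `Lᵖ⁺¹`. -/
def envRec : ℕ → Submodule k (UniversalEnvelopingAlgebra k L)
  | 0 => ⊤
  | 1 => augmentation k L
  | p + 2 => envRec (p + 1) * augmentation k L +
      ⊤ * (F.toFun (p + 2)).map
        (UniversalEnvelopingAlgebra.ι k : L →ₗ⁅k⁆ UniversalEnvelopingAlgebra k L).toLinearMap * ⊤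

end LieFiltration

end Enveloping

end

/-! Surjectivity is formal. `F^d` is spanned by products of total weight at least `d`; those of
weight exactly `d` are images of products of classes, and the heavier ones vanish in `F^d/F^(d+1)`.

Injectivity is a weighted form of the Poincaré–Birkhoff–Witt theorem. Distinct degrees of `U(gr L)`
land in distinct summands, so it suffices to treat `u` of degree `d`. Choose a basis of `L` adapted
to `L^0 ⊇ ... ⊇ L^(d+1)` and order it. Sorting products shows that `u` is a combination `∑ c_M y^M`
of ordered monomials of weight `d` in the classes of the basis vectors
(`envGrDegree_le_span_orderedProd`). If `u` maps to `0`, the same combination `z = ∑ c_M x^M` in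
`U(L)` lies in `F^(d+1)`. Now let `U(L)` act on polynomials in the basis vectors as in the classical
proof of PBW. Then `z` sends `1` to the polynomial `c` (`PBW.rep_orderedProd_apply`), while the
action respects weights up to `d+1`, so `c` has only monomials of weight at least `d+1`
(`rep_apply_mem_weightGE`). Hence `c = 0` and `u = 0`. Only the spanning half of PBW is used for `gr
L`; independence is used for `L`. Stopping at a finite step means that no basis adapted to the whole
filtration is required.

For the recursive filtration, `R^p ⊆ F^p` is an induction. If `R` is multiplicative, `R^0 = U(L)`
makes each `R^p` a two-sided ideal; then `R` is decreasing, and since `L^i` maps into `R^i`, every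
generator of `F^p` lies in `R^p`. -/

noncomputable section

/-! ### The representation of `U(L)` on polynomials, with degree and weight estimates -/

namespace PBW

variable {k L I : Type*} [Field k] [LieRing L] [LieAlgebra k L]

/-- A linear map sends the vectors supported in `s` to `T` if it does so on the basis vectors. -/
theorem map_mem_of_supported {α V : Type*} [AddCommGroup V] [Module k V] {s : Set α}
    {f : (α →₀ k) →ₗ[k] V} {T : Submodule k V} (h : ∀ a ∈ s, f (Finsupp.single a 1) ∈ T)
    {v : α →₀ k} (hv : v ∈ Finsupp.supported k k s) : f v ∈ T := by
  rw [Finsupp.supported_eq_span_single] at hv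
  have : Submodule.span k ((fun i => Finsupp.single i (1 : k)) '' s) ≤ T.comap f := by
    rw [Submodule.span_le]
    rintro _ ⟨a, ha, rfl⟩
    exact h a ha
  exact this hv

variable (b : Module.Basis I k L)

/-- The polynomials of degree at most `n`. -/
abbrev degLE (k I : Type*) [Field k] (n : ℕ) : Submodule k (Multiset I →₀ k) :=
  Finsupp.supported k k {M | M.card ≤ n}

theorem degLE_mono {m n : ℕ} (h : m ≤ n) : degLE k I m ≤ degLE k I n :=
  Finsupp.supported_mono fun _ hM => le_trans (Set.mem_ofPred.1 hM) h

theorem single_mem_degLE {M : Multiset I} {n : ℕ} (h : M.card ≤ n) :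
    Finsupp.single M 1 ∈ degLE k I n :=
  Finsupp.single_mem_supported k _ h

theorem act_mem_of_basis {T : Submodule k (Multiset I →₀ k)}
    {f : L →ₗ[k] (Multiset I →₀ k) →ₗ[k] (Multiset I →₀ k)} {s : Set I} {t : Set (Multiset I)}
    (h : ∀ i ∈ s, ∀ M ∈ t, f (b i) (Finsupp.single M 1) ∈ T)
    {x : L} (hx : ∀ i, b.repr x i ≠ 0 → i ∈ s) {v : Multiset I →₀ k}
    (hv : v ∈ Finsupp.supported k k t) : f x v ∈ T := by
  refine map_mem_of_supported (fun M hM => ?_) hv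
  rw [← b.linearCombination_repr x, Finsupp.linearCombination_apply, Finsupp.sum, map_sum,
    LinearMap.sum_apply]
  refine Submodule.sum_mem _ fun i hi => ?_
  rw [map_smul, LinearMap.smul_apply]
  exact T.smul_mem _ (h i (hx i (Finsupp.mem_support_iff.1 hi)) M hM)

/-- The polynomials all of whose monomials have weight at least `q`. -/
abbrev weightGE (k : Type*) [Field k] (w : I → ℕ) (q : ℕ) : Submodule k (Multiset I →₀ k) :=
  Finsupp.supported k k {M | q ≤ (M.map w).sum}

theorem weightGE_mono {w : I → ℕ} {p q : ℕ} (h : p ≤ q) : weightGE k w q ≤ weightGE k w p :=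
  Finsupp.supported_mono fun _ hM => le_trans h (Set.mem_ofPred.1 hM)

theorem single_mem_weightGE {w : I → ℕ} {M : Multiset I} {q : ℕ} (h : q ≤ (M.map w).sum) :
    Finsupp.single M 1 ∈ weightGE k w q :=
  Finsupp.single_mem_supported k _ h

/-- The map `f` is arbitrary so that this applies both to `actAux b n` inside an induction and to
`act b`. -/
theorem mem_weightGE_of_basis {w : I → ℕ} {D : ℕ}
    {f : L →ₗ[k] (Multiset I →₀ k) →ₗ[k] (Multiset I →₀ k)}
    (h : ∀ i M, f (b i) (Finsupp.single M 1) ∈ weightGE k w (min (w i + (M.map w).sum) D))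
    {p q : ℕ} {x : L} (hx : ∀ i, b.repr x i ≠ 0 → p ≤ w i) {v : Multiset I →₀ k}
    (hv : v ∈ weightGE k w q) : f x v ∈ weightGE k w (min (p + q) D) := by
  refine act_mem_of_basis b (s := {i | p ≤ w i}) (fun i hi M hM => ?_) hx hv
  have hi' : p ≤ w i := hi
  have hM' : q ≤ (M.map w).sum := hM
  exact weightGE_mono (by omega) (h i M)

variable [LinearOrder I]

/-- The approximations, correct on monomials of degree at most `n`, of the action of a Lie algebra
with ordered basis `b` on the space of polynomials in the basis vectors. -/
def actAux : ℕ → L →ₗ[k] (Multiset I →₀ k) →ₗ[k] (Multiset I →₀ k)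
  | 0 => b.constr k fun i => Finsupp.linearCombination k fun M => Finsupp.single (i ::ₘ M) 1
  | n + 1 => b.constr k fun i => Finsupp.linearCombination k fun M =>
      if M.card ≤ n then actAux n (b i) (Finsupp.single M 1)
      else match M.sort with
        | [] => Finsupp.single (i ::ₘ M) 1
        | j :: N =>
          if i ≤ j then Finsupp.single (i ::ₘ M) 1
          else Finsupp.single (i ::ₘ M) 1
            + actAux n (b j) (actAux n (b i) (Finsupp.single (N : Multiset I) 1)
                - Finsupp.single (i ::ₘ (N : Multiset I)) 1)
            + actAux n ⁅b i, b j⁆ (Finsupp.single (N : Multiset I) 1)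

/-- The action of a Lie algebra with ordered basis `b` on the space of polynomials in the basis
vectors, in which `b i` multiplies by the `i`-th variable the monomials in variables of index at
least `i`. -/
def act : L →ₗ[k] (Multiset I →₀ k) →ₗ[k] (Multiset I →₀ k) :=
  b.constr k fun i => Finsupp.linearCombination k fun M =>
    actAux b M.card (b i) (Finsupp.single M 1)

theorem actAux_zero (i : I) (M : Multiset I) :
    actAux b 0 (b i) (Finsupp.single M 1) = Finsupp.single (i ::ₘ M) 1 := by
  simp [actAux]

theorem actAux_succ_of_card_le {n : ℕ} (i : I) {M : Multiset I} (h : M.card ≤ n) :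
    actAux b (n + 1) (b i) (Finsupp.single M 1) = actAux b n (b i) (Finsupp.single M 1) := by
  simp [actAux, h]

theorem actAux_succ_of_le {n : ℕ} {i : I} {M : Multiset I} (hn : n < M.card)
    (h : ∀ j ∈ M, i ≤ j) :
    actAux b (n + 1) (b i) (Finsupp.single M 1) = Finsupp.single (i ::ₘ M) 1 := by
  simp only [actAux, Module.Basis.constr_basis, Finsupp.linearCombination_single, one_smul,
    if_neg hn.not_ge]
  split
  · rfl
  · next j N hN =>
    rw [if_pos (h j ((Multiset.mem_sort (· ≤ ·)).1 (hN ▸ List.mem_cons_self)))]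

theorem actAux_succ_of_lt {n : ℕ} {i j : I} {N : Multiset I} (hn : n ≤ N.card)
    (h : ∀ l ∈ N, j ≤ l) (hij : j < i) :
    actAux b (n + 1) (b i) (Finsupp.single (j ::ₘ N) 1) = Finsupp.single (i ::ₘ j ::ₘ N) 1
      + actAux b n (b j) (actAux b n (b i) (Finsupp.single N 1) - Finsupp.single (i ::ₘ N) 1)
      + actAux b n ⁅b i, b j⁆ (Finsupp.single N 1) := by
  have hn' : ¬ (j ::ₘ N).card ≤ n := by simp; omega
  simp only [actAux, Module.Basis.constr_basis, Finsupp.linearCombination_single, one_smul,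
    if_neg hn', Multiset.sort_cons j N (· ≤ ·) h, if_neg hij.not_ge, Multiset.sort_eq]

theorem exists_min_cons {M : Multiset I} (hM : M ≠ 0) :
    ∃ j N, M = j ::ₘ N ∧ ∀ l ∈ N, j ≤ l := by
  have hs := M.pairwise_sort (· ≤ ·)
  have he := M.sort_eq (· ≤ ·)
  match h : M.sort (· ≤ ·) with
  | [] => rw [h] at he; exact (hM he.symm).elim
  | j :: N =>
    rw [h] at he hs
    exact ⟨j, N, he.symm, fun l hl => (List.pairwise_cons.1 hs).1 l hl⟩

/-- The three cases in the recursive definition of the action. -/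
theorem actAux_succ_cases (n : ℕ) (i : I) (M : Multiset I) :
    actAux b (n + 1) (b i) (Finsupp.single M 1) = actAux b n (b i) (Finsupp.single M 1) ∨
    actAux b (n + 1) (b i) (Finsupp.single M 1) = Finsupp.single (i ::ₘ M) 1 ∨
    ∃ j N, M = j ::ₘ N ∧
    actAux b (n + 1) (b i) (Finsupp.single M 1) = Finsupp.single (i ::ₘ M) 1
      + actAux b n (b j) (actAux b n (b i) (Finsupp.single N 1) - Finsupp.single (i ::ₘ N) 1)
      + actAux b n ⁅b i, b j⁆ (Finsupp.single N 1) := by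
  rcases le_or_gt M.card n with h | h
  · exact .inl (actAux_succ_of_card_le b i h)
  · obtain ⟨j, N, rfl, hj⟩ := exists_min_cons (M := M) (by rintro rfl; simp at h)
    rcases lt_or_ge j i with hij | hij
    · exact .inr (.inr ⟨j, N, rfl, actAux_succ_of_lt b (by simpa [Nat.lt_succ_iff] using h) hj hij⟩)
    · refine .inr (.inl (actAux_succ_of_le b h fun l hl => ?_))
      rcases Multiset.mem_cons.1 hl with rfl | hl
      · exact hij
      · exact hij.trans (hj l hl)

/-- Stages after the one numbered by the degree of `M` leave the value on `M` unchanged. -/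
theorem actAux_of_card_le {n : ℕ} (x : L) {M : Multiset I} (h : M.card ≤ n) :
    actAux b n x (Finsupp.single M 1) = act b x (Finsupp.single M 1) := by
  have : (actAux b n).flip (Finsupp.single M 1) = (act b).flip (Finsupp.single M 1) := by
    refine b.ext fun i => ?_
    simp only [LinearMap.flip_apply, act, Module.Basis.constr_basis,
      Finsupp.linearCombination_single, one_smul]
    induction n, h using Nat.le_induction with
    | base => rfl
    | succ n hn ih => rw [actAux_succ_of_card_le b i hn, ih]
  exact LinearMap.congr_fun this x

theorem actAux_of_mem_degLE {n : ℕ} (x : L) {v : Multiset I →₀ k} (h : v ∈ degLE k I n) :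
    actAux b n x v = act b x v := by
  have := map_mem_of_supported (f := actAux b n x - act b x) (T := ⊥)
    (fun M hM => by simp [actAux_of_card_le b x hM]) h
  simpa [sub_eq_zero] using this

theorem actAux_mem_degLE_of_sub_mem {n : ℕ}
    (h : ∀ i M, actAux b n (b i) (Finsupp.single M 1) - Finsupp.single (i ::ₘ M) 1
      ∈ degLE k I M.card) (m : ℕ) (x : L) {v : Multiset I →₀ k} (hv : v ∈ degLE k I m) :
    actAux b n x v ∈ degLE k I (m + 1) := by
  refine act_mem_of_basis b (s := Set.univ) (fun i _ M hM => ?_) (fun i _ => trivial) hv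
  rw [← sub_add_cancel (actAux b n (b i) (Finsupp.single M 1)) (Finsupp.single (i ::ₘ M) 1)]
  have hM' : M.card ≤ m := hM
  exact add_mem (degLE_mono (by omega) (h i M)) (single_mem_degLE (by simpa using hM'))

/-- The correction terms start from `N`, of degree one less than `M`. By induction the remainder of
`b i · N` has degree at most that of `N`, and each further application raises the degree by at most
one. -/
theorem actAux_sub_mem (n : ℕ) (i : I) (M : Multiset I) :
    actAux b n (b i) (Finsupp.single M 1) - Finsupp.single (i ::ₘ M) 1 ∈ degLE k I M.card := by
  induction n generalizing i M with
  | zero => rw [actAux_zero, sub_self]; exact zero_mem _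
  | succ n ih =>
    rcases actAux_succ_cases b n i M with h | h | ⟨j, N, rfl, h⟩
    · rw [h]; exact ih i M
    · rw [h, sub_self]; exact zero_mem _
    · rw [h, add_assoc, add_sub_cancel_left, Multiset.card_cons]
      exact add_mem (actAux_mem_degLE_of_sub_mem b ih _ _ (ih i N))
        (actAux_mem_degLE_of_sub_mem b ih _ _ (single_mem_degLE le_rfl))

theorem act_sub_mem (i : I) (M : Multiset I) :
    act b (b i) (Finsupp.single M 1) - Finsupp.single (i ::ₘ M) 1 ∈ degLE k I M.card := by
  rw [← actAux_of_card_le b _ le_rfl]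
  exact actAux_sub_mem b _ i M

theorem act_of_le {i : I} {M : Multiset I} (h : ∀ j ∈ M, i ≤ j) :
    act b (b i) (Finsupp.single M 1) = Finsupp.single (i ::ₘ M) 1 := by
  rw [← actAux_of_card_le b _ le_rfl]
  rcases hM : M.card with _ | n
  · rw [actAux_zero]
  · exact actAux_succ_of_le b (by omega) h

/-- This is the recursive clause of `actAux` read backwards, once the stages are replaced by `act`.
-/
theorem act_comm_of_lt {i j : I} {N : Multiset I} (h : ∀ l ∈ N, j ≤ l) (hij : j < i) :
    act b (b i) (act b (b j) (Finsupp.single N 1))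
      = act b (b j) (act b (b i) (Finsupp.single N 1)) + act b ⁅b i, b j⁆ (Finsupp.single N 1) := by
  rw [act_of_le b h, ← actAux_of_card_le b (b i) (M := j ::ₘ N) le_rfl, Multiset.card_cons,
    actAux_succ_of_lt b le_rfl h hij, actAux_of_card_le b _ le_rfl, actAux_of_card_le b _ le_rfl,
    actAux_of_mem_degLE b _ (act_sub_mem b i N), map_sub,
    act_of_le b (M := i ::ₘ N) (i := j), Multiset.cons_swap]
  · abel
  · intro l hl
    rcases Multiset.mem_cons.1 hl with rfl | hl
    · exact hij.le
    · exact h l hl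

/-- The defect of the relation is bilinear and alternating in `x` and `y`, so pairs `j < i` of basis
indices suffice. -/
theorem act_lie_of_basis {v : Multiset I →₀ k} (h : ∀ i j, j < i → act b (b i) (act b (b j) v)
      = act b (b j) (act b (b i) v) + act b ⁅b i, b j⁆ v) (x y : L) :
    act b x (act b y v) = act b y (act b x v) + act b ⁅x, y⁆ v := by
  let f : L →ₗ[k] L →ₗ[k] (Multiset I →₀ k) := LinearMap.mk₂ k
    (fun x y => act b x (act b y v) - act b y (act b x v) - act b ⁅x, y⁆ v)
    (by intros; simp; abel) (by intros; simp [smul_sub]) (by intros; simp; abel)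
    (by intros; simp [smul_sub])
  have hf : f = 0 := by
    refine b.ext fun i => b.ext fun j => ?_
    rcases lt_trichotomy i j with hij | rfl | hij
    · have hs : act b ⁅b i, b j⁆ v = - act b ⁅b j, b i⁆ v := by
        rw [← lie_skew, map_neg, LinearMap.neg_apply]
      simp [f, h j i hij, hs]
    · simp [f]
    · simp [f, h i j hij]
  have := LinearMap.congr_fun₂ hf x y
  simp only [f, LinearMap.mk₂_apply, LinearMap.zero_apply] at this
  rw [sub_sub, sub_eq_zero] at this
  exact this

/-- Induction on the degree. If `j` is at most every index in `N`, the relation is built into the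
action. Otherwise `N = l ::ₘ P` with `l < j < i` and `l` minimal, so `N` is `b l` applied to `P`;
moving `b l` to the front on both sides reduces the relation to lower degree and the Jacobi
identity. -/
theorem act_lie_of_card (n : ℕ) : ∀ (N : Multiset I), N.card ≤ n → ∀ x y : L,
    act b x (act b y (Finsupp.single N 1))
      = act b y (act b x (Finsupp.single N 1)) + act b ⁅x, y⁆ (Finsupp.single N 1) := by
  induction n with
  | zero =>
    intro N hN
    obtain rfl : N = 0 := by simpa using hN
    exact act_lie_of_basis b fun i j hij => act_comm_of_lt b (by simp) hij
  | succ n ih =>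
    have ih' : ∀ v ∈ degLE k I n, ∀ x y : L,
        act b x (act b y v) = act b y (act b x v) + act b ⁅x, y⁆ v := by
      intro v hv x y
      have := map_mem_of_supported (f := act b x ∘ₗ act b y - (act b y ∘ₗ act b x + act b ⁅x, y⁆))
        (T := ⊥) (fun M hM => by simp [ih M hM x y]) hv
      simpa [sub_eq_zero] using this
    intro N hN
    refine act_lie_of_basis b fun i j hij => ?_
    by_cases hj : ∀ l ∈ N, j ≤ l
    · exact act_comm_of_lt b hj hij
    obtain ⟨l, P, rfl, hl⟩ := exists_min_cons (M := N) (by rintro rfl; simp at hj)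
    have hP : P.card ≤ n := by simpa using hN
    have hlj : l < j := by
      by_contra! hlj
      refine hj fun m hm => ?_
      rcases Multiset.mem_cons.1 hm with rfl | hm
      · exact hlj
      · exact hlj.trans (hl m hm)
    have hPd : Finsupp.single P 1 ∈ degLE k I n := single_mem_degLE hP
    -- moving the action of `b l` to the left in front of two others
    have move : ∀ {i j : I}, l < i → l < j →
        act b (b i) (act b (b j) (act b (b l) (Finsupp.single P 1)))
          = act b (b l) (act b (b i) (act b (b j) (Finsupp.single P 1)))
            + act b ⁅b i, b l⁆ (act b (b j) (Finsupp.single P 1))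
            + act b ⁅b j, b l⁆ (act b (b i) (Finsupp.single P 1))
            + act b ⁅b i, ⁅b j, b l⁆⁆ (Finsupp.single P 1) := by
      intro i j hi hj
      -- The vector `b j · P` may have degree `n + 1`, beyond the induction hypothesis. Its leading
      -- monomial `j ::ₘ P` is covered by the minimality of `l`, the remainder by induction.
      have h1 : act b (b i) (act b (b l) (act b (b j) (Finsupp.single P 1)))
          = act b (b l) (act b (b i) (act b (b j) (Finsupp.single P 1)))
            + act b ⁅b i, b l⁆ (act b (b j) (Finsupp.single P 1)) := by
        have h2 := ih' _ (degLE_mono hP (act_sub_mem b j P)) (b i) (b l)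
        have h3 : ∀ m ∈ j ::ₘ P, l ≤ m := by
          intro m hm
          rcases Multiset.mem_cons.1 hm with rfl | hm
          · exact hj.le
          · exact hl m hm
        have h4 := act_comm_of_lt b h3 hi
        simp only [map_sub] at h2
        have h5 := congrArg₂ (· + ·) h2 h4
        simp only [sub_add_cancel] at h5
        rw [h5]; abel
      rw [ih' _ hPd (b j) (b l), map_add, h1, ih' _ hPd (b i) ⁅b j, b l⁆]
      abel
    rw [← act_of_le b hl, move (hlj.trans hij) hlj, move hlj (hlj.trans hij),
      ih' _ hPd ⁅b i, b j⁆ (b l), ih' _ hPd (b i) (b j), map_add,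
      lie_lie (b i) (b j) (b l), map_sub, LinearMap.sub_apply]
    abel

theorem act_lie (x y : L) : act b ⁅x, y⁆ = act b x ∘ₗ act b y - act b y ∘ₗ act b x := by
  refine Finsupp.lhom_ext' fun M => LinearMap.ext_ring ?_
  simp [act_lie_of_card b _ M le_rfl x y]

/-- Every term of the recursion preserves total weight, except that a bracket is only known to have
weight at least `min (w i + w j) D`; hence the truncation at `D`. -/
theorem actAux_mem_weightGE {w : I → ℕ} {D : ℕ}
    (hb : ∀ i j l, b.repr ⁅b i, b j⁆ l ≠ 0 → min (w i + w j) D ≤ w l) (n : ℕ) (i : I)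
    (M : Multiset I) :
    actAux b n (b i) (Finsupp.single M 1) ∈ weightGE k w (min (w i + (M.map w).sum) D) := by
  induction n generalizing i M with
  | zero =>
    rw [actAux_zero]
    exact single_mem_weightGE (by simp)
  | succ n ih =>
    rcases actAux_succ_cases b n i M with h | h | ⟨j, N, rfl, h⟩
    · rw [h]; exact ih i M
    · rw [h]; exact single_mem_weightGE (by simp)
    · rw [h]
      have h1 := mem_weightGE_of_basis b (p := w j) ih (x := b j)
        (fun i hi => by
          rw [b.repr_self, Finsupp.single_apply_ne_zero] at hi
          rw [hi.1])
        (sub_mem (ih i N) (single_mem_weightGE (M := i ::ₘ N) (by simp)))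
      have h2 := mem_weightGE_of_basis b ih (hb i j) (single_mem_weightGE (M := N) le_rfl)
      refine add_mem (add_mem (single_mem_weightGE (by simp)) (weightGE_mono ?_ h1))
        (weightGE_mono ?_ h2) <;>
      · rw [Multiset.map_cons, Multiset.sum_cons]; omega

theorem act_mem_weightGE {w : I → ℕ} {D : ℕ}
    (hb : ∀ i j l, b.repr ⁅b i, b j⁆ l ≠ 0 → min (w i + w j) D ≤ w l)
    {p q : ℕ} {x : L} (hx : ∀ i, b.repr x i ≠ 0 → p ≤ w i) {v : Multiset I →₀ k}
    (hv : v ∈ weightGE k w q) : act b x v ∈ weightGE k w (min (p + q) D) := by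
  refine mem_weightGE_of_basis b (fun i M => ?_) hx hv
  rw [← actAux_of_card_le b _ le_rfl]
  exact actAux_mem_weightGE b hb _ i M

section Representation

attribute [local instance 100] LieRing.ofAssociativeRing

/-- The representation of the enveloping algebra on the space of polynomials in the basis
vectors. -/
def rep : UniversalEnvelopingAlgebra k L →ₐ[k] Module.End k (Multiset I →₀ k) :=
  UniversalEnvelopingAlgebra.lift k
    { toFun := fun x => (act b x : Module.End k (Multiset I →₀ k))
      map_add' := map_add (act b)
      map_smul' := map_smul (act b)
      map_lie' := fun {x y} => by
        rw [LieRing.of_associative_ring_bracket]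
        exact act_lie b x y }

theorem rep_ι (x : L) : rep b (UniversalEnvelopingAlgebra.ι k x) = act b x :=
  UniversalEnvelopingAlgebra.lift_ι_apply _ _ x

/-- The ordered monomial with factors `f i` for `i` in `M`. -/
def orderedProd {A : Type*} [Monoid A] (f : I → A) (M : Multiset I) : A :=
  ((M.sort (· ≤ ·)).map f).prod

theorem orderedProd_cons {A : Type*} [Monoid A] (f : I → A) {i : I} {M : Multiset I}
    (h : ∀ j ∈ M, i ≤ j) : orderedProd f (i ::ₘ M) = f i * orderedProd f M := by
  rw [orderedProd, Multiset.sort_cons i M (· ≤ ·) h, List.map_cons, List.prod_cons, orderedProd]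

/-- The ordered monomials act on `1` by the corresponding monomials. -/
theorem rep_orderedProd_apply (M : Multiset I) :
    rep b (orderedProd (fun i => UniversalEnvelopingAlgebra.ι k (b i)) M) (Finsupp.single 0 1)
      = Finsupp.single M 1 := by
  induction hn : M.card generalizing M with
  | zero =>
    obtain rfl : M = 0 := by simpa using hn
    simp [orderedProd]
  | succ n ih =>
    obtain ⟨j, N, rfl, hj⟩ := exists_min_cons (M := M) (by rintro rfl; simp at hn)
    rw [orderedProd_cons _ hj, map_mul, Module.End.mul_apply, ih N (by simpa using hn), rep_ι,
      act_of_le b hj]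

end Representation

end PBW

end

noncomputable section

/-! ### Components of the associated graded space and bases adapted to a flag -/

section Graded

variable {k V : Type*} [Field k] [AddCommGroup V] [Module k V]

/-- The component of degree `i` of an element of the associated graded space. -/
def grComponent (F : ℕ → Submodule k V) (i : ℕ) : GrSpace F →ₗ[k] GrPiece F i :=
  DirectSum.component k ℕ (GrPiece F) i

theorem grComponent_grClass_self (F : ℕ → Submodule k V) (i : ℕ) (x : F i) :
    grComponent F i (grClass F i x) = Submodule.Quotient.mk x :=
  DirectSum.component.lof_self k i _

theorem grComponent_grClass_of_ne (F : ℕ → Submodule k V) {i j : ℕ} (h : i ≠ j) (x : F i) :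
    grComponent F j (grClass F i x) = 0 :=
  (DirectSum.component.of k j i _).trans (dif_neg h)

theorem grClass_eq_zero_iff (F : ℕ → Submodule k V) (i : ℕ) (x : F i) :
    grClass F i x = 0 ↔ (x : V) ∈ F (i + 1) := by
  have hx : (Submodule.Quotient.mk x : GrPiece F i) = 0 ↔ (x : V) ∈ F (i + 1) := by
    rw [Submodule.Quotient.mk_eq_zero]
    exact Submodule.mem_comap
  rw [← hx, ← grComponent_grClass_self]
  refine ⟨fun h => by rw [h, map_zero], fun h => ?_⟩
  rw [grComponent_grClass_self] at h
  exact (congrArg (grOf F i) h).trans (map_zero _)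

/-- A monotone family of subspaces has bases which are contained in a single one. -/
theorem exists_linearIndepOn_monotone {G : ℕ → Submodule k V} (hG : Monotone G) (D : ℕ) :
    ∃ B : Set V, LinearIndepOn k id B ∧ B ⊆ G D ∧
      ∀ p ≤ D, G p ≤ Submodule.span k (B ∩ G p) := by
  induction D with
  | zero =>
    obtain ⟨B, h1, -, h3, h4⟩ :=
      exists_linearIndepOn_id_extension (linearIndependent_empty k V) (Set.empty_subset (G 0 : Set V))
    refine ⟨B, h4, h1, fun p hp => ?_⟩
    obtain rfl : p = 0 := by omega
    rw [Set.inter_eq_left.2 h1]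
    exact h3
  | succ D ih =>
    obtain ⟨B, h1, h2, h3⟩ := ih
    obtain ⟨B', g1, g2, g3, g4⟩ := exists_linearIndepOn_id_extension h1
      (h2.trans (hG (Nat.le_succ D)))
    refine ⟨B', g4, g1, fun p hp => ?_⟩
    rcases Nat.le_succ_iff.1 hp with hp | rfl
    · exact (h3 p hp).trans (Submodule.span_mono (Set.inter_subset_inter_left _ g2))
    · rw [Set.inter_eq_left.2 g1]
      exact g3

end Graded

/-! ### Sorting products modulo shorter ones of the same weight -/

section OrderedProducts

variable {k A I : Type*} [Field k] [Ring A] [Algebra k A] (y : I → A) (w : I → ℕ)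

/-- The span of the products of total weight `e` of the elements `y i`. -/
def prodSpan (k : Type*) [Field k] [Algebra k A] (e : ℕ) : Submodule k A :=
  Submodule.span k {u | ∃ l : List I, (l.map w).sum = e ∧ u = (l.map y).prod}

/-- The span of the products of total weight `e` of less than `n` elements `y i`. -/
def prodSpanLT (k : Type*) [Field k] [Algebra k A] (n e : ℕ) : Submodule k A :=
  Submodule.span k {u | ∃ l : List I, l.length < n ∧ (l.map w).sum = e ∧ u = (l.map y).prod}

variable {y w}

theorem prodSpan_mul_le (p q : ℕ) : prodSpan y w k p * prodSpan y w k q ≤ prodSpan y w k (p + q) := by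
  unfold prodSpan
  rw [Submodule.span_mul_span]
  refine Submodule.span_mono ?_
  rintro _ ⟨_, ⟨l, rfl, rfl⟩, _, ⟨m, rfl, rfl⟩, rfl⟩
  exact ⟨l ++ m, by simp, by simp⟩

theorem mul_mem_prodSpanLT (i : I) {n e : ℕ} {u : A} (hu : u ∈ prodSpanLT y w k n e) :
    y i * u ∈ prodSpanLT y w k (n + 1) (w i + e) := by
  have : prodSpanLT y w k n e ≤
      (prodSpanLT y w k (n + 1) (w i + e)).comap (LinearMap.mulLeft k (y i)) := by
    rw [prodSpanLT, Submodule.span_le]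
    rintro _ ⟨l, h1, rfl, rfl⟩
    exact Submodule.subset_span ⟨i :: l, by simpa using h1, by simp, by simp⟩
  exact this hu

/-- An adjacent swap costs a commutator, which replaces two factors by a combination of single ones
of the same weight. -/
theorem prod_sub_prod_mem_of_perm {D : ℕ}
    (hy : ∀ i j, w i + w j ≤ D →
      y i * y j - y j * y i ∈ Submodule.span k (y '' {l | w l = w i + w j}))
    {l m : List I} (h : l.Perm m) (hl : (l.map w).sum ≤ D) :
    (l.map y).prod - (m.map y).prod ∈ prodSpanLT y w k l.length (l.map w).sum := by
  induction h with
  | nil => simp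
  | cons a h ih =>
    simp only [List.map_cons, List.prod_cons, List.sum_cons, List.length_cons, ← mul_sub] at hl ⊢
    exact mul_mem_prodSpanLT a (ih (by omega))
  | swap a b l =>
    simp only [List.map_cons, List.prod_cons, List.sum_cons, List.length_cons] at hl ⊢
    rw [← mul_assoc, ← mul_assoc, ← sub_mul, ← add_assoc]
    have : Submodule.span k (y '' {l | w l = w b + w a}) ≤
        (prodSpanLT y w k (l.length + 1 + 1) (w b + w a + (l.map w).sum)).comap
          (LinearMap.mulRight k (l.map y).prod) := by
      rw [Submodule.span_le]
      rintro _ ⟨c, hc, rfl⟩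
      have hc' : w c = w b + w a := hc
      exact Submodule.subset_span ⟨c :: l, by simp, by simp [hc'], by simp⟩
    exact this (hy b a (by omega))
  | trans h1 h2 ih1 ih2 =>
    rw [← sub_add_sub_cancel]
    refine add_mem (ih1 hl) ?_
    rw [h1.length_eq, (h1.map w).sum_eq]
    exact ih2 (by rwa [← (h1.map w).sum_eq])

/-- Induction on the number of factors: a product differs from its sorted version by shorter
products of the same weight. -/
theorem prodSpan_le_orderedProd [LinearOrder I] {D : ℕ}
    (hy : ∀ i j, w i + w j ≤ D →
      y i * y j - y j * y i ∈ Submodule.span k (y '' {l | w l = w i + w j}))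
    {e : ℕ} (he : e ≤ D) :
    prodSpan y w k e ≤ Submodule.span k (PBW.orderedProd y '' {M | (M.map w).sum = e}) := by
  have key : ∀ n, prodSpanLT y w k n e ≤
      Submodule.span k (PBW.orderedProd y '' {M | (M.map w).sum = e}) := by
    intro n
    induction n with
    | zero =>
      rw [prodSpanLT, Submodule.span_le]
      rintro _ ⟨l, h, -⟩
      exact absurd h (Nat.not_lt_zero _)
    | succ n ih =>
      rw [prodSpanLT, Submodule.span_le]
      rintro _ ⟨l, hn, rfl, rfl⟩
      have hp : l.Perm ((l : Multiset I).sort (· ≤ ·)) :=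
        Multiset.coe_eq_coe.1 (Multiset.sort_eq _ _).symm
      rw [SetLike.mem_coe, ← sub_add_cancel (l.map y).prod
        (((l : Multiset I).sort (· ≤ ·)).map y).prod]
      refine add_mem (ih ?_) (Submodule.subset_span ⟨l, by simp, rfl⟩)
      refine Submodule.span_mono ?_ (prod_sub_prod_mem_of_perm hy hp he)
      rintro u ⟨m, h1, h2, h3⟩
      exact ⟨m, by omega, h2, h3⟩
  rw [prodSpan, Submodule.span_le]
  rintro _ ⟨l, h, rfl⟩
  exact key (l.length + 1) (Submodule.subset_span ⟨l, by simp, h, rfl⟩)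

end OrderedProducts

/-! ### Generation of `U(L)` and adapted bases of `L` -/

namespace UniversalEnvelopingAlgebra

variable {k L : Type*} [Field k] [LieRing L] [LieAlgebra k L]

/-- The enveloping algebra is spanned by the products of elements of the Lie algebra. -/
theorem span_prod_ι :
    Submodule.span k {u : UniversalEnvelopingAlgebra k L | ∃ l : List L, u = (l.map (ι k)).prod}
      = ⊤ := by
  set S := Submodule.span k
    {u : UniversalEnvelopingAlgebra k L | ∃ l : List L, u = (l.map (ι k)).prod}
  have hmul : S * S ≤ S := by
    rw [Submodule.span_mul_span]
    refine Submodule.span_mono ?_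
    rintro _ ⟨_, ⟨l, rfl⟩, _, ⟨m, rfl⟩, rfl⟩
    exact ⟨l ++ m, by simp⟩
  have hone : (1 : UniversalEnvelopingAlgebra k L) ∈ S := Submodule.subset_span ⟨[], by simp⟩
  refine eq_top_iff.2 fun u _ => ?_
  obtain ⟨t, rfl⟩ : ∃ t, mkAlgHom k L t = u := RingCon.mkₐ_surjective _ u
  induction t using TensorAlgebra.induction with
  | algebraMap r =>
    rw [AlgHom.commutes, Algebra.algebraMap_eq_smul_one]
    exact S.smul_mem r hone
  | ι x => exact Submodule.subset_span ⟨[x], by simp⟩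
  | mul a b ha hb =>
    rw [map_mul]
    exact hmul (Submodule.mul_mem_mul (ha trivial) (hb trivial))
  | add a b ha hb =>
    rw [map_add]
    exact add_mem (ha trivial) (hb trivial)

end UniversalEnvelopingAlgebra

namespace LieFiltration

variable {k L : Type*} [Field k] [LieRing L] [LieAlgebra k L] (F : LieFiltration k L)

theorem zero_eq_top : F.toFun 0 = ⊤ :=
  top_le_iff.1 (F.one_eq_top ▸ F.antitone (Nat.zero_le 1))

/-- A basis adapted to the first `D` steps of a filtration. -/
theorem exists_adapted_basis (D : ℕ) :
    ∃ (B : Set L) (b : Module.Basis B k L) (w : B → ℕ), (∀ i, b i ∈ F.toFun (w i)) ∧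
      ∀ p ≤ D, ∀ x ∈ F.toFun p, ∀ i, b.repr x i ≠ 0 → p ≤ w i := by
  classical
  -- Reversing the index gives an increasing flag: the basis starts in `L^D` and is extended up to
  -- `L^0 = L`.
  obtain ⟨B, h1, -, h3⟩ := exists_linearIndepOn_monotone (k := k) (G := fun m => F.toFun (D - m))
    (fun m n hmn => F.antitone (by omega)) D
  have h4 : ∀ p ≤ D, F.toFun p ≤ Submodule.span k (B ∩ F.toFun p) := by
    intro p hp
    have := h3 (D - p) (by omega)
    rwa [show D - (D - p) = p by omega] at this
  have hspan : ⊤ ≤ Submodule.span k (Set.range ((↑) : B → L)) := by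
    rw [Subtype.range_coe, ← F.zero_eq_top]
    exact (h4 0 (Nat.zero_le D)).trans (Submodule.span_mono Set.inter_subset_left)
  let b : Module.Basis B k L := Module.Basis.mk h1 hspan
  have hb : ∀ i, b i = i := fun i => Module.Basis.mk_apply h1 hspan i
  -- The weight is the last step up to `D` containing the vector; the cap keeps it finite for
  -- vectors in every `L^p`.
  refine ⟨B, b, fun i => Nat.findGreatest (fun p => (i : L) ∈ F.toFun p) D, fun i => ?_,
    fun p hp x hx i hi => ?_⟩
  · rw [hb]
    exact Nat.findGreatest_spec (P := fun p => (i : L) ∈ F.toFun p) (Nat.zero_le D)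
      (by simp [F.zero_eq_top])
  · have h5 : x ∈ Submodule.span k (b '' {i | (i : L) ∈ F.toFun p}) := by
      refine Submodule.span_mono ?_ (h4 p hp hx)
      rintro y ⟨hy, hy'⟩
      exact ⟨⟨y, hy⟩, hy', hb _⟩
    exact Nat.le_findGreatest hp ((b.mem_span_image.1 h5) (Finsupp.mem_support_iff.2 hi))

theorem cls_eq_zero {i : ℕ} (x : F.toFun i) (h : (x : L) ∈ F.toFun (i + 1)) : F.cls i x = 0 :=
  (grClass_eq_zero_iff _ _ _).2 h

end LieFiltration

end

noncomputable section

/-! ### The natural map on products, and its surjectivity -/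

namespace LieFiltration

open UniversalEnvelopingAlgebra

attribute [local instance 100] LieRing.ofAssociativeRing

variable {k L : Type*} [Field k] [LieRing L] [LieAlgebra k L] (F : LieFiltration k L)

theorem prod_mem_env (l : List (Σ i, F.toFun i)) :
    (l.map fun a => ι k (a.2 : L)).prod ∈ F.env.toFun (l.map Sigma.fst).sum :=
  Submodule.subset_span ⟨l.map fun a => (a.1, (a.2 : L)), fun a ha => by
    obtain ⟨b, -, rfl⟩ := List.mem_map.1 ha
    exact b.2.2, by simp [Function.comp_def], by simp [Function.comp_def]⟩

/-- The pairs of `u ∈ U(gr L)` and `z ∈ Fᵈ` such that the image of `u` in `gr U(L)` is the class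
of `z`. -/
def liftPairs (d : ℕ) :
    Submodule k (UniversalEnvelopingAlgebra k F.Gr × UniversalEnvelopingAlgebra k L) where
  carrier := {u | ∃ h : u.2 ∈ F.env.toFun d, F.naturalMap u.1 = F.env.cls d ⟨u.2, h⟩}
  zero_mem' := ⟨zero_mem _, (map_zero _).trans (map_zero (F.env.cls d)).symm⟩
  add_mem' := by
    rintro ⟨u, z⟩ ⟨u', z'⟩ ⟨h, hu⟩ ⟨h', hu'⟩
    refine ⟨add_mem h h', ?_⟩
    change F.naturalMap (u + u') = _
    rw [map_add, hu, hu', ← map_add]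
    rfl
  smul_mem' := by
    rintro c ⟨u, z⟩ ⟨h, hu⟩
    refine ⟨Submodule.smul_mem _ c h, ?_⟩
    change F.naturalMap (c • u) = _
    rw [map_smul, hu, ← map_smul]
    rfl

theorem naturalMap_prod (l : List (Σ i, F.toFun i)) :
    F.naturalMap (l.map fun a => ι k (F.cls a.1 a.2)).prod
      = F.env.cls (l.map Sigma.fst).sum ⟨_, F.prod_mem_env l⟩ := by
  induction l with
  | nil => exact map_one _
  | cons a l ih =>
    change F.naturalMap (ι k (F.cls a.1 a.2) * (l.map fun a => ι k (F.cls a.1 a.2)).prod) = _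
    rw [map_mul, ih, naturalMap_ι_cls, AlgFiltration.cls_mul_cls]
    rfl

theorem prod_mem_liftPairs (l : List (Σ i, F.toFun i)) :
    ((l.map fun a => ι k (F.cls a.1 a.2)).prod, (l.map fun a => ι k (a.2 : L)).prod)
      ∈ F.liftPairs (l.map Sigma.fst).sum :=
  ⟨F.prod_mem_env l, F.naturalMap_prod l⟩

theorem map_envGrDegree_le (d : ℕ) :
    (F.envGrDegree d).map F.naturalMap.toLinearMap ≤ F.env.degree d := by
  rw [envGrDegree, Submodule.map_span_le]
  rintro _ ⟨l, rfl, rfl⟩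
  exact ⟨_, (F.naturalMap_prod l).symm⟩

theorem exists_sigma_list (l : List (ℕ × L)) (h : ∀ a ∈ l, a.2 ∈ F.toFun a.1) :
    ∃ m : List (Σ i, F.toFun i), (m.map Sigma.fst).sum = (l.map Prod.fst).sum ∧
      (m.map fun a => ι k (a.2 : L)).prod = (l.map fun a => ι k a.2).prod := by
  induction l with
  | nil => exact ⟨[], rfl, rfl⟩
  | cons a l ih =>
    obtain ⟨m, h1, h2⟩ := ih fun a ha => h a (List.mem_cons_of_mem _ ha)
    refine ⟨⟨a.1, a.2, h a List.mem_cons_self⟩ :: m, ?_, ?_⟩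
    · rw [List.map_cons, List.sum_cons, h1, List.map_cons, List.sum_cons]
    · rw [List.map_cons, List.prod_cons, h2, List.map_cons, List.prod_cons]

theorem env_cls_eq_zero_iff {d : ℕ} (z : F.env.toFun d) :
    F.env.cls d z = 0 ↔ (z : UniversalEnvelopingAlgebra k L) ∈ F.env.toFun (d + 1) :=
  grClass_eq_zero_iff _ _ _

/-- A product of total weight exactly `d` is the image of the product of classes; a heavier one lies
in `F^(d+1)`, so its class is zero. -/
theorem prod_cls_mem_map_envGrDegree {d : ℕ} (l : List (ℕ × L))
    (h1 : ∀ a ∈ l, a.2 ∈ F.toFun a.1) (h2 : d ≤ (l.map Prod.fst).sum)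
    (hz : (l.map fun a => ι k a.2).prod ∈ F.env.toFun d) :
    F.env.cls d ⟨_, hz⟩ ∈ (F.envGrDegree d).map F.naturalMap.toLinearMap := by
  rcases h2.eq_or_lt with h2 | h2
  · obtain ⟨m, hm1, hm2⟩ := F.exists_sigma_list l h1
    have hm : (m.map fun a => ι k (F.cls a.1 a.2)).prod ∈ F.envGrDegree d :=
      Submodule.subset_span ⟨m, hm1.trans h2.symm, rfl⟩
    rw [← F.env.cls_congr (hm1.trans h2.symm) ⟨_, F.prod_mem_env m⟩ ⟨_, hz⟩ hm2,
      ← F.naturalMap_prod m]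
    exact Submodule.mem_map_of_mem hm
  · rw [(F.env_cls_eq_zero_iff _).2 (Submodule.subset_span ⟨l, h1, h2, rfl⟩)]
    exact zero_mem _

theorem degree_le_map_envGrDegree (d : ℕ) :
    F.env.degree d ≤ (F.envGrDegree d).map F.naturalMap.toLinearMap := by
  rintro _ ⟨⟨z, hz⟩, rfl⟩
  -- The class is defined only on `F^d`, so the condition is pushed forward to `U(L)`, where it can
  -- be checked on the spanning products.
  have key : F.env.toFun d ≤
      (((F.envGrDegree d).map F.naturalMap.toLinearMap).comap (F.env.cls d)).map
        (F.env.toFun d).subtype := by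
    refine Submodule.span_le.2 ?_
    rintro _ ⟨l, h1, h2, rfl⟩
    exact ⟨⟨_, Submodule.subset_span ⟨l, h1, h2, rfl⟩⟩,
      F.prod_cls_mem_map_envGrDegree l h1 h2 _, rfl⟩
  obtain ⟨z', hz', h⟩ := key hz
  obtain rfl : z' = ⟨z, hz⟩ := Subtype.ext h
  exact hz'

theorem naturalMap_surjective : Function.Surjective F.naturalMap := by
  intro v
  induction v using F.env.gr_ind with
  | h0 => exact ⟨0, map_zero _⟩
  | hadd x y hx hy =>
    obtain ⟨a, rfl⟩ := hx
    obtain ⟨b, rfl⟩ := hy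
    exact ⟨a + b, map_add _ _ _⟩
  | hc i x =>
    obtain ⟨u, -, hu⟩ := F.degree_le_map_envGrDegree i ⟨x, rfl⟩
    exact ⟨u, hu⟩

theorem one_mem_envGrDegree : 1 ∈ F.envGrDegree 0 :=
  Submodule.subset_span ⟨[], by simp⟩

theorem envGrDegree_mul_le (p q : ℕ) :
    F.envGrDegree p * F.envGrDegree q ≤ F.envGrDegree (p + q) := by
  unfold envGrDegree
  rw [Submodule.span_mul_span]
  refine Submodule.span_mono ?_
  rintro _ ⟨_, ⟨l, rfl, rfl⟩, _, ⟨m, rfl, rfl⟩, rfl⟩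
  exact ⟨l ++ m, by simp, by simp⟩

theorem ι_mem_iSup_envGrDegree (x : F.Gr) : ι k x ∈ ⨆ d, F.envGrDegree d := by
  induction x using F.gr_ind with
  | h0 => rw [map_zero]; exact zero_mem _
  | hadd x y hx hy => rw [map_add]; exact add_mem hx hy
  | hc i x => exact Submodule.mem_iSup_of_mem i (Submodule.subset_span ⟨[⟨i, x⟩], by simp, by simp⟩)

theorem iSup_envGrDegree : ⨆ d, F.envGrDegree d = ⊤ := by
  have hmul : (⨆ d, F.envGrDegree d) * (⨆ d, F.envGrDegree d) ≤ ⨆ d, F.envGrDegree d := by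
    rw [Submodule.iSup_mul]
    refine iSup_le fun p => ?_
    rw [Submodule.mul_iSup]
    exact iSup_le fun q => (F.envGrDegree_mul_le p q).trans (le_iSup F.envGrDegree (p + q))
  rw [← top_le_iff, ← span_prod_ι, Submodule.span_le]
  rintro _ ⟨l, rfl⟩
  induction l with
  | nil => exact Submodule.mem_iSup_of_mem 0 F.one_mem_envGrDegree
  | cons x l ih =>
    rw [List.map_cons, List.prod_cons]
    exact hmul (Submodule.mul_mem_mul (F.ι_mem_iSup_envGrDegree x) ih)

/-! ### Ordered monomials in an adapted basis, and their weights -/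

section AdaptedBasis

variable {F} {I : Type*} {b : Module.Basis I k L} {w : I → ℕ} {D : ℕ}
  (hw : ∀ i, b i ∈ F.toFun (w i))
  (hb : ∀ p ≤ D, ∀ x ∈ F.toFun p, ∀ i, b.repr x i ≠ 0 → p ≤ w i)

include hb in
-- Only basis vectors of weight at least `p` occur in `x`, and those of weight above `p` vanish in
-- `L^p/L^(p+1)`.
theorem ι_cls_mem_span {p : ℕ} (hp : p ≤ D) (x : F.toFun p) :
    ι k (F.cls p x)
      ∈ Submodule.span k ((fun i => ι k (F.cls (w i) ⟨b i, hw i⟩)) '' {i | w i = p}) := by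
  have hm : ∀ i ∈ (b.repr x).support, b i ∈ F.toFun p := fun i hi =>
    F.antitone (hb p hp x x.2 i (Finsupp.mem_support_iff.1 hi)) (hw i)
  have hx : x = ∑ i ∈ (b.repr x).support.attach, b.repr x i • (⟨b i, hm i i.2⟩ : F.toFun p) := by
    refine Subtype.ext ?_
    conv_lhs => rw [← b.linearCombination_repr x, Finsupp.linearCombination_apply, Finsupp.sum,
      ← Finset.sum_attach]
    simp
  rw [hx, map_sum, map_sum]
  refine Submodule.sum_mem _ fun i _ => ?_
  rw [map_smul, map_smul]
  refine Submodule.smul_mem _ _ ?_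
  rcases (hb p hp x x.2 i (Finsupp.mem_support_iff.1 i.2)).eq_or_lt with h | h
  · refine Submodule.subset_span ⟨i, h.symm, ?_⟩
    exact congrArg _ (F.cls_congr h.symm _ _ rfl)
  · rw [F.cls_eq_zero _ (F.antitone h (hw i)), map_zero]
    exact zero_mem _

include hb in
theorem envGrDegree_le_prodSpan {d : ℕ} (hd : d ≤ D) :
    F.envGrDegree d ≤ prodSpan (fun i => ι k (F.cls (w i) ⟨b i, hw i⟩)) w k d := by
  rw [envGrDegree, Submodule.span_le]
  rintro _ ⟨l, rfl, rfl⟩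
  induction l with
  | nil => exact Submodule.subset_span ⟨[], by simp⟩
  | cons a l ih =>
    rw [List.map_cons, List.sum_cons] at hd ⊢
    rw [List.map_cons, List.prod_cons]
    refine prodSpan_mul_le _ _ (Submodule.mul_mem_mul ?_ (ih (by omega)))
    refine Submodule.span_mono ?_ (ι_cls_mem_span hw hb (by omega : a.1 ≤ D) a.2)
    rintro _ ⟨i, hi, rfl⟩
    exact ⟨[i], by simpa using hi, by simp⟩

include hb in
theorem envGrDegree_le_span_orderedProd [LinearOrder I] {d : ℕ} (hd : d ≤ D) :
    F.envGrDegree d ≤ Submodule.span k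
      (PBW.orderedProd (fun i => ι k (F.cls (w i) ⟨b i, hw i⟩)) '' {M | (M.map w).sum = d}) := by
  refine (envGrDegree_le_prodSpan hw hb hd).trans (prodSpan_le_orderedProd (fun i j hij => ?_) hd)
  have h := ι_cls_mem_span hw hb hij
    ⟨⁅b i, b j⁆, F.lie_mem _ _ _ (hw i) _ (hw j)⟩
  rw [← F.lie_cls (w i) (w j) ⟨b i, hw i⟩ ⟨b j, hw j⟩] at h
  convert h using 1
  exact ((LieHom.map_lie _ _ _).trans (LieRing.of_associative_ring_bracket _ _)).symm

include hw hb in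
theorem repr_lie_ne_zero (i j l : I) (h : b.repr ⁅b i, b j⁆ l ≠ 0) : min (w i + w j) D ≤ w l :=
  hb _ (min_le_right _ _) _
    (F.antitone (min_le_left _ _) (F.lie_mem _ _ _ (hw i) _ (hw j))) l h

include hw hb in
/-- The representation of the enveloping algebra on polynomials is compatible with weights. -/
theorem rep_apply_mem_weightGE [LinearOrder I] {z : UniversalEnvelopingAlgebra k L} {p : ℕ}
    (hz : z ∈ F.env.toFun p) :
    PBW.rep b z (Finsupp.single 0 1) ∈ PBW.weightGE k w (min p D) := by
  have key : F.env.toFun p ≤ (PBW.weightGE k w (min p D)).comap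
      ((PBW.rep b).toLinearMap.flip (Finsupp.single 0 1)) := by
    refine Submodule.span_le.2 ?_
    rintro _ ⟨l, h1, h2, rfl⟩
    change PBW.rep b _ (Finsupp.single 0 1) ∈ PBW.weightGE k w (min p D)
    -- Passing to the exact total weight of the list makes the claim suitable for induction on it.
    refine PBW.weightGE_mono (min_le_min_right D h2) ?_
    clear h2
    induction l with
    | nil => simpa using PBW.single_mem_weightGE (M := 0) (by simp)
    | cons a l ih =>
      rw [List.map_cons (f := fun a : ℕ × L => ι k a.2), List.prod_cons, map_mul,
        Module.End.mul_apply, PBW.rep_ι]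
      -- The basis is adapted only up to `D`, so a factor of larger declared weight is treated as
      -- one of weight `D`.
      have ha := hb (min a.1 D) (min_le_right _ _) a.2
        (F.antitone (min_le_left _ _) (h1 a List.mem_cons_self))
      refine PBW.weightGE_mono ?_ (PBW.act_mem_weightGE b (repr_lie_ne_zero hw hb) ha
        (ih fun a ha => h1 a (List.mem_cons_of_mem _ ha)))
      rw [List.map_cons, List.sum_cons]
      omega
  exact key hz

theorem orderedProd_mem_liftPairs [LinearOrder I] (M : Multiset I) :
    (PBW.orderedProd (fun i => ι k (F.cls (w i) ⟨b i, hw i⟩)) M,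
      PBW.orderedProd (fun i => ι k (b i)) M) ∈ F.liftPairs (M.map w).sum := by
  have h := F.prod_mem_liftPairs
    ((M.sort (· ≤ ·)).map fun i => (⟨w i, b i, hw i⟩ : Σ i, F.toFun i))
  simp only [List.map_map, Function.comp_def] at h
  rw [PBW.orderedProd, PBW.orderedProd]
  convert h
  conv_lhs => rw [← M.sort_eq (· ≤ ·), Multiset.map_coe, Multiset.sum_coe]

end AdaptedBasis

/-! ### Injectivity of the natural map -/

theorem eq_zero_of_naturalMap_eq_zero {d : ℕ} {u : UniversalEnvelopingAlgebra k F.Gr}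
    (hu : u ∈ F.envGrDegree d) (h0 : F.naturalMap u = 0) : u = 0 := by
  -- Step `d + 1` is needed to separate weight exactly `d` from weight at least `d + 1`.
  obtain ⟨I, b, w, hw, hb⟩ := F.exists_adapted_basis (d + 1)
  classical
  let : LinearOrder I := linearOrderOfSTO WellOrderingRel
  obtain ⟨c, hc, rfl⟩ := (Finsupp.mem_span_image_iff_linearCombination k).1
    (envGrDegree_le_span_orderedProd hw hb (Nat.le_succ d) hu)
  set y := PBW.orderedProd (fun i => ι k (F.cls (w i) ⟨b i, hw i⟩))
  let x := PBW.orderedProd (fun i : I => ι k (b i))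
  -- Since `liftPairs` is a subspace, the same coefficients `c` give an element of `U(gr L)` and a
  -- lift of its image.
  have hxy : ((Finsupp.linearCombination k y).prod (Finsupp.linearCombination k x)) c
      ∈ F.liftPairs d := by
    refine PBW.map_mem_of_supported (fun M hM => ?_) hc
    have hM' : (M.map w).sum = d := hM
    have := orderedProd_mem_liftPairs (F := F) hw M
    rw [hM'] at this
    simpa [-ι_apply] using this
  obtain ⟨h1, h2⟩ := hxy
  have h3 : Finsupp.linearCombination k x c ∈ F.env.toFun (d + 1) :=
    (F.env_cls_eq_zero_iff _).1 (h2.symm.trans h0)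
  have h4 := rep_apply_mem_weightGE hw hb h3
  -- Acting on the polynomial `1` recovers the coefficients.
  have h5 : PBW.rep b (Finsupp.linearCombination k x c) (Finsupp.single 0 1) = c := by
    have : (PBW.rep b).toLinearMap.flip (Finsupp.single 0 1) ∘ₗ Finsupp.linearCombination k x
        = LinearMap.id := by
      refine Finsupp.lhom_ext' fun M => LinearMap.ext_ring ?_
      simpa [x] using PBW.rep_orderedProd_apply b M
    exact LinearMap.congr_fun this c
  rw [h5, min_self] at h4
  have h6 : c = 0 := by
    by_contra hne
    obtain ⟨M, hM⟩ := Finsupp.support_nonempty_iff.2 hne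
    have e1 : (M.map w).sum = d := hc hM
    have e2 : d + 1 ≤ (M.map w).sum := h4 hM
    omega
  rw [h6, map_zero]

/-- The homogeneous parts of `u` map to different summands of `gr U(L)`, so each of them maps to
zero. -/
theorem naturalMap_injective : Function.Injective F.naturalMap := by
  refine (injective_iff_map_eq_zero _).2 fun u hu => ?_
  obtain ⟨f, hf, rfl⟩ := (Submodule.mem_iSup_iff_exists_finsupp _ _).1
    (F.iSup_envGrDegree ▸ Submodule.mem_top : u ∈ ⨆ d, F.envGrDegree d)
  refine Finset.sum_eq_zero fun d hd => F.eq_zero_of_naturalMap_eq_zero (hf d) ?_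
  have hz : ∀ e, ∃ z, F.env.cls e z = F.naturalMap (f e) := fun e =>
    F.map_envGrDegree_le e ⟨f e, hf e, rfl⟩
  choose z hz using hz
  rw [Finsupp.sum, map_sum] at hu
  have h1 : grComponent F.env.toFun d (∑ e ∈ f.support, F.naturalMap (f e))
      = Submodule.Quotient.mk (z d) := by
    refine (map_sum (grComponent F.env.toFun d) _ _).trans ?_
    rw [Finset.sum_eq_single_of_mem d hd]
    · rw [← hz]; exact grComponent_grClass_self _ _ _
    · intro e _ hed
      rw [← hz]; exact grComponent_grClass_of_ne _ hed _
  replace h1 := h1.symm.trans ((congrArg (grComponent F.env.toFun d) hu).trans (map_zero _))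
  change F.naturalMap (f d) = 0
  rw [← hz]
  exact (congrArg (grOf F.env.toFun d) h1).trans (map_zero _)

/-! ### Comparison with the recursively defined filtration -/

section Recursive

theorem env_zero : F.env.toFun 0 = ⊤ := by
  rw [← top_le_iff, ← span_prod_ι, Submodule.span_le]
  rintro _ ⟨l, rfl⟩
  exact Submodule.subset_span ⟨l.map fun x => (0, x), by simp [F.zero_eq_top], by simp,
    by simp [Function.comp_def, -ι_apply]⟩

theorem env_one_le_augmentation : F.env.toFun 1 ≤ augmentation k L := by
  refine Submodule.span_le.2 ?_
  rintro _ ⟨l, -, h2, rfl⟩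
  match l with
  | [] => simp at h2
  | a :: l =>
    change UniversalEnvelopingAlgebra.lift k _ _ = 0
    rw [List.map_cons, List.prod_cons, map_mul, lift_ι_apply, LieHom.zero_apply, zero_mul]

/-- `U(L) = k·1 + F^1`, and the counit kills `F^1` and is the identity on scalars. -/
theorem augmentation_le_env_one : augmentation k L ≤ F.env.toFun 1 := by
  intro u hu
  have h : (⊤ : Submodule k (UniversalEnvelopingAlgebra k L)) ≤
      Submodule.span k {1} ⊔ F.env.toFun 1 := by
    rw [← span_prod_ι, Submodule.span_le]
    rintro _ ⟨l, rfl⟩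
    match l with
    | [] => exact Submodule.mem_sup_left (Submodule.subset_span (by simp))
    | x :: l =>
      refine Submodule.mem_sup_right (Submodule.subset_span
        ⟨(x :: l).map fun x => (1, x), by simp [F.one_eq_top], by simp,
          by simp [Function.comp_def, -ι_apply]⟩)
  obtain ⟨a, ha, v, hv, rfl⟩ := Submodule.mem_sup.1 (h (Submodule.mem_top (x := u)))
  obtain ⟨c, rfl⟩ := Submodule.mem_span_singleton.1 ha
  have hv' : UniversalEnvelopingAlgebra.lift k (0 : L →ₗ⁅k⁆ k) v = 0 :=
    F.env_one_le_augmentation hv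
  have hu' : UniversalEnvelopingAlgebra.lift k (0 : L →ₗ⁅k⁆ k) (c • 1 + v) = 0 := hu
  rw [map_add, map_smul, map_one, hv', add_zero, smul_eq_mul, mul_one] at hu'
  rw [hu', zero_smul, zero_add]
  exact hv

theorem env_mul_le (p q : ℕ) : F.env.toFun p * F.env.toFun q ≤ F.env.toFun (p + q) :=
  Submodule.mul_le.2 (F.env.mul_mem p q)

theorem env_mul_map_mul_le (p : ℕ) :
    ⊤ * (F.toFun p).map (ι k : L →ₗ⁅k⁆ UniversalEnvelopingAlgebra k L).toLinearMap * ⊤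
      ≤ F.env.toFun p := by
  have h : (F.toFun p).map (ι k : L →ₗ⁅k⁆ UniversalEnvelopingAlgebra k L).toLinearMap
      ≤ F.env.toFun p := Submodule.map_le_iff_le_comap.2 fun x hx => F.ι_mem_env p x hx
  rw [← F.env_zero]
  have h1 := F.env_mul_le 0 p
  rw [zero_add] at h1
  exact (mul_le_mul' ((mul_le_mul' le_rfl h).trans h1) le_rfl).trans (F.env_mul_le p 0)

theorem envRec_le_env (p : ℕ) : F.envRec p ≤ F.env.toFun p := by
  induction p with
  | zero => rw [env_zero]; exact le_top
  | succ p ih =>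
    match p with
    | 0 => exact F.augmentation_le_env_one
    | p + 1 =>
      exact sup_le ((mul_le_mul' ih F.augmentation_le_env_one).trans (F.env_mul_le (p + 1) 1))
        (F.env_mul_map_mul_le (p + 2))

theorem ι_mem_envRec (p : ℕ) {x : L} (hx : x ∈ F.toFun p) : ι k x ∈ F.envRec p := by
  match p with
  | 0 => exact Submodule.mem_top
  | 1 => exact F.env_one_le_augmentation (F.ι_mem_env 1 x hx)
  | p + 2 =>
    refine Submodule.mem_sup_right ?_
    have h : ι k x ∈ (F.toFun (p + 2)).map
      (ι k : L →ₗ⁅k⁆ UniversalEnvelopingAlgebra k L).toLinearMap := ⟨x, hx, rfl⟩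
    simpa using Submodule.mul_mem_mul
      (Submodule.mul_mem_mul (Submodule.mem_top (x := (1 : UniversalEnvelopingAlgebra k L))) h)
      (Submodule.mem_top (x := (1 : UniversalEnvelopingAlgebra k L)))

variable {F}

/-- Multiplicativity with `R^0 = U(L)` makes `R^p` a two-sided ideal; it contains `L^p ⊇ L^(p+1)`,
hence both summands of `R^(p+1)`. -/
theorem envRec_succ_le (hR : ∀ p q, F.envRec p * F.envRec q ≤ F.envRec (p + q)) (p : ℕ) :
    F.envRec (p + 1) ≤ F.envRec p := by
  match p with
  | 0 => exact le_top
  | p + 1 =>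
    have hr : F.envRec (p + 1) * ⊤ ≤ F.envRec (p + 1) := hR (p + 1) 0
    have hl : ⊤ * F.envRec (p + 1) ≤ F.envRec (p + 1) := by
      have h := hR 0 (p + 1)
      rwa [zero_add] at h
    refine sup_le ((mul_le_mul' le_rfl le_top).trans hr) ?_
    refine le_trans (mul_le_mul' (le_trans (mul_le_mul' le_rfl ?_) hl)
      le_rfl) hr
    exact Submodule.map_le_iff_le_comap.2 fun x hx =>
      F.ι_mem_envRec (p + 1) (F.antitone (Nat.le_succ _) hx)

theorem env_le_envRec (hR : ∀ p q, F.envRec p * F.envRec q ≤ F.envRec (p + q)) (p : ℕ) :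
    F.env.toFun p ≤ F.envRec p := by
  refine Submodule.span_le.2 ?_
  rintro _ ⟨l, h1, h2, rfl⟩
  -- As `R` is decreasing, it is enough to place the product in `R` at its exact total weight.
  refine antitone_nat_of_succ_le (envRec_succ_le hR) h2 ?_
  clear h2
  induction l with
  | nil => exact Submodule.mem_top
  | cons a l ih =>
    rw [List.map_cons, List.sum_cons, List.map_cons, List.prod_cons]
    exact hR _ _ (Submodule.mul_mem_mul (F.ι_mem_envRec _ (h1 a List.mem_cons_self))
      (ih fun a ha => h1 a (List.mem_cons_of_mem _ ha)))

end Recursive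

end LieFiltration

end

theorem mainTheorem9 {k L : Type*} [Field k] [CharZero k] [LieRing L] [LieAlgebra k L]
    (F : LieFiltration k L) :
    -- the natural map is an isomorphism of graded algebras
    (Function.Bijective F.naturalMap ∧
      ∀ d, (F.envGrDegree d).map F.naturalMap.toLinearMap = F.env.degree d) ∧
    -- the filtration contains the recursively defined one, and they agree
    -- whenever the latter is multiplicative
    (∀ p, F.envRec p ≤ F.env.toFun p) ∧
    ((∀ p q, F.envRec p * F.envRec q ≤ F.envRec (p + q)) →
      ∀ p, F.envRec p = F.env.toFun p) :=
  ⟨⟨⟨F.naturalMap_injective, F.naturalMap_surjective⟩, fun d =>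
      le_antisymm (F.map_envGrDegree_le d) (F.degree_le_map_envGrDegree d)⟩,
    F.envRec_le_env, fun hR p =>
      le_antisymm (F.envRec_le_env p) (LieFiltration.env_le_envRec hR p)⟩
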